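/- Let $K$ be a field, let $L$ be a (non-empty) finite lattice with minimum $m$, and let $A=KL$ be its incidence algebra, with basis the elements $p_x^y$ ($x\le y$ in $L$) and products $p_x^y\,p_y^z=p_x^z$, and $p_x^y\,p_w^z=0$ if $y\neq w$. For $x\in L$ let $P(x)=p_x^xA$ be the corresponding indecomposable projective right $A$-module; for $x\le y$ the canonical map $P(y)\to P(x)$ is left multiplication by $p_x^y$. For a finite subset $S\subseteq L$ let $\vee S$ be its join, with $\vee\emptyset=m$. Let $C$ be an antichain in $L$ with $\ell$ elements, put $N_C=\sum_{x\in C}p_m^xA\subseteq P(m)$, and let $M_C=P(m)/N_C$ be the antichain module of $C$. Fix any total ordering of $C$. The antichain resolution of $M_C$ is $$0\to P_\ell\xrightarrow{\partial_\ell}\cdots\xrightarrow{\partial_2}P_1\xrightarrow{\partial_1}P_0\xrightarrow{\partial_0}M_C\to 0,\qquad P_r=\bigoplus_{S\subseteq C,\ |S|=r}P(\vee S),$$ where $\partial_0$ is the canonical projection $P_0=P(m)\to M_C$ and, for $r\ge 1$, the component $P(\vee S)\to P(\vee(S\setminus\{y\}))$ of $\partial_r$ for $y\in S$ is $(-1)^{|\{z\in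 S\,:\,z\text{ precedes }y\}|}$ times the canonical map, all other components being zero. Then this sequence is a projective resolution of $M_C$, and it is a minimal projective resolution (that is, $\ker\partial_r$ is a superfluous submodule of $P_r$ for every $r\ge 0$) if and only if $C$ is strong, i.e. for all subsets $S,S'$ of $C$, $\vee S\le\vee S'$ implies $S\subseteq S'$. -/

import Mathlib

open MulOpposite

namespace AntichainResolution

section Homological

variable {R : Type*} [Ring R]

/-- A submodule `N` of `M` is superfluous (small) if `N + X = M` forces `X = M`. -/
def IsSuperfluous {M : Type*} [AddCommGroup M] [Module R M] (N : Submodule R M) : Prop :=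
  ∀ X : Submodule R M, N ⊔ X = ⊤ → X = ⊤

/-- `⋯ → P 2 → P 1 → P 0 → M → 0`, with maps `d n : P (n + 1) → P n` and augmentation
`ε : P 0 → M`, is a projective resolution of `M`. -/
structure IsProjectiveResolution {P : ℕ → Type*} [∀ n, AddCommGroup (P n)]
    [∀ n, Module R (P n)] {M : Type*} [AddCommGroup M] [Module R M]
    (d : ∀ n, P (n + 1) →ₗ[R] P n) (ε : P 0 →ₗ[R] M) : Prop where
  projective : ∀ n, Module.Projective R (P n)
  surjective : Function.Surjective ε
  exact_zero : Function.Exact (d 0) ε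
  exact_succ : ∀ n, Function.Exact (d (n + 1)) (d n)

/-- A minimal projective resolution: every `P n` is a projective cover of its image, that is,
the kernel of every map of the resolution (the augmentation included) is superfluous. -/
structure IsMinimalProjectiveResolution {P : ℕ → Type*} [∀ n, AddCommGroup (P n)]
    [∀ n, Module R (P n)] {M : Type*} [AddCommGroup M] [Module R M]
    (d : ∀ n, P (n + 1) →ₗ[R] P n) (ε : P 0 →ₗ[R] M) : Prop
    extends IsProjectiveResolution d ε where
  superfluous_zero : IsSuperfluous (LinearMap.ker ε)
  superfluous_succ : ∀ n, IsSuperfluous (LinearMap.ker (d n))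

end Homological

lemma insert_mem {L : Type*} [DecidableEq L] {C T : Finset L} {r : ℕ} {y : L}
    (hT : T ∈ C.powersetCard r) (hy : y ∈ C \ T) : insert y T ∈ C.powersetCard (r + 1) := by
  rw [Finset.mem_powersetCard] at hT ⊢
  rw [Finset.mem_sdiff] at hy
  exact ⟨Finset.insert_subset hy.1 hT.1, by rw [Finset.card_insert_of_notMem hy.2, hT.2]⟩

noncomputable section

variable (K : Type*) [Field K] {L : Type*} [Lattice L]

/-- The basis element `p_a^b` of the incidence algebra (the path from `a` to `b`) for `a ≤ b`;
it is `0` if `a ≤ b` fails. -/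
def path (a b : L) : IncidenceAlgebra K L where
  toFun u v := open Classical in if a ≤ b ∧ u = a ∧ v = b then 1 else 0
  eq_zero_of_not_le' := by
    rintro u v huv
    rw [if_neg]
    rintro ⟨h, rfl, rfl⟩
    exact huv h

lemma path_apply [DecidableEq L] [DecidableLE L] (a b u v : L) :
    path K a b u v = if a ≤ b ∧ u = a ∧ v = b then 1 else 0 := by
  unfold path
  simp only [IncidenceAlgebra.coe_mk]
  congr

variable [LocallyFiniteOrder L] [DecidableEq L]

lemma path_self_mul_path (a b : L) : path K a a * path K a b = path K a b := by
  classical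
  ext u v huv
  rw [IncidenceAlgebra.mul_apply, Finset.sum_eq_single u]
  · simp only [path_apply]
    by_cases h : u = a <;> simp [h]
  · intro w _ hw
    simp only [path_apply]
    rw [if_neg, zero_mul]
    rintro ⟨_, rfl, rfl⟩
    exact hw rfl
  · intro hu
    exact absurd (Finset.mem_Icc.2 ⟨le_rfl, huv⟩) hu

/-- The indecomposable projective right module `P(a) = e_a A` over the incidence algebra `A`,
where `e_a = p_a^a`. Right `A`-modules are modules over `Aᵐᵒᵖ`. -/
def projModule (a : L) : Submodule (IncidenceAlgebra K L)ᵐᵒᵖ (IncidenceAlgebra K L) :=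
  Submodule.span _ {path K a a}

lemma path_mul_mem (a b : L) (f : IncidenceAlgebra K L) :
    path K a b * f ∈ projModule K a := by
  refine Submodule.mem_span_singleton.2 ⟨op (path K a b * f), ?_⟩
  rw [op_smul_eq_mul, ← mul_assoc, path_self_mul_path]

/-- The canonical map `P(b) → P(a)` for `a ≤ b`: left multiplication by the path `p_a^b`. -/
def canonicalMap (a b : L) :
    projModule K b →ₗ[(IncidenceAlgebra K L)ᵐᵒᵖ] projModule K a where
  toFun f := ⟨path K a b * f, path_mul_mem K a b f⟩
  map_add' _ _ := Subtype.ext (mul_add _ _ _)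
  map_smul' r f := Subtype.ext (mul_smul_comm r (path K a b) (f : IncidenceAlgebra K L))

variable [OrderBot L]

/-- The right ideal `N_C = ∑_{x ∈ C} p_m^x A`, where `m = ⊥` is the minimum of `L`. -/
def antichainIdeal (C : Finset L) :
    Submodule (IncidenceAlgebra K L)ᵐᵒᵖ (IncidenceAlgebra K L) :=
  Submodule.span _ (path K ⊥ '' (C : Set L))

/-- The antichain module `M_C = P(m) / N_C`. -/
abbrev AntichainModule (C : Finset L) : Type _ :=
  projModule K (⊥ : L) ⧸ (antichainIdeal K C).submoduleOf (projModule K (⊥ : L))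

/-- The `r`-th term `P_r = ⨁_{S ⊆ C, |S| = r} P(⋁ S)` (a finite direct sum). -/
abbrev Term (C : Finset L) (r : ℕ) : Type _ :=
  (S : {S : Finset L // S ∈ C.powersetCard r}) → projModule K (S.1.sup id)

/-- The boundary map `∂_{r+1} : P_{r+1} → P_r`. With respect to the ordering of `C` by the values of
`o`, its component `P(⋁ S) → P(⋁ (S \ {y}))`, for `y ∈ S`, is the canonical map with the
Koszul sign `(-1) ^ #{z ∈ S | z comes before y}`, and all other components vanish. It is written
here by its values in the summand of `T`; there `S = T ∪ {y}` with `y ∈ C \ T`. -/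
def boundary (C : Finset L) (o : L → ℕ) (r : ℕ) :
    Term K C (r + 1) →ₗ[(IncidenceAlgebra K L)ᵐᵒᵖ] Term K C r :=
  LinearMap.pi fun T => ∑ y : {y : L // y ∈ C \ T.1},
    ((-1 : ℤ) ^ ((insert y.1 T.1).filter fun z => o z < o y.1).card) •
      (canonicalMap K (T.1.sup id) ((insert y.1 T.1).sup id) ∘ₗ
        LinearMap.proj (⟨insert y.1 T.1, insert_mem T.2 y.2⟩ :
          {S : Finset L // S ∈ C.powersetCard (r + 1)}))

/-- The augmentation `∂_0 : P_0 = P(⋁ ∅) = P(m) → M_C`, the canonical projection. The only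
summand of `P_0` is that of `∅`, and `canonicalMap` is the identity of `P(m)` here. -/
def augmentation (C : Finset L) :
    Term K C 0 →ₗ[(IncidenceAlgebra K L)ᵐᵒᵖ] AntichainModule K C :=
  Submodule.mkQ _ ∘ₗ canonicalMap K ⊥ ((∅ : Finset L).sup id) ∘ₗ
    LinearMap.proj (⟨∅, by simp⟩ : {S : Finset L // S ∈ C.powersetCard 0})

end

/-- `C` is strong: `⋁ S ≤ ⋁ S'` implies `S ⊆ S'` for all subsets `S`, `S'` of `C`;
the join of the empty set is the minimum. -/
def IsStrong {L : Type*} [Lattice L] [OrderBot L] (C : Finset L) : Prop :=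
  ∀ S ⊆ C, ∀ S' ⊆ C, S.sup id ≤ S'.sup id → S ⊆ S'

end AntichainResolution

/-!
The resolution is studied one vertex at a time. An element of `P(a)` is determined by its row at
`a`, so an element of `P_r` is a family of chains indexed by `v ∈ L`: the chain at `v` gives to each
`r`-subset `S` of `C` the coefficient of `p_{⋁ S}^v` in the summand `P(⋁ S)` (`coeff`). Canonical
maps only relabel rows, so on the chains at `v` the map `∂` is the augmented simplicial boundary
operator (`coeff_boundary`). The chains at `v` are those of the full simplex with vertices
`{x ∈ C | x ≤ v}`, since `⋁ S ≤ v` means that all elements of `S` lie below `v`.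

A full simplex with at least one vertex has an acyclic augmented complex: joining its first vertex
to the other simplices is a contracting homotopy (`simplexBoundary_cone`). If no element of `C` lies
below `v`, then only the empty simplex contributes, and it spans the part of `M_C` at `v`. Both
cases are combined in `mem_range_boundary`, which gives exactness everywhere.

For minimality, call the coefficient of `p_{⋁ S}^{⋁ S}` the leading coefficient at `S`. A
submodule of `P_r` without leading coefficients is superfluous
(`isSuperfluous_of_coeff_sup_eq_zero`), and boundaries have none if `⋁ (T ∪ {y}) ≠ ⋁ T` whenever
`y ∉ T`. Conversely, if `⋁ (T ∪ {y}) = ⋁ T`, then some boundary has leading coefficient `±1` at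
`T`, and the range of `∂` is not superfluous (`sup_insert_ne_of_isSuperfluous`). The
condition on joins is equivalent to strength (`isStrong_iff`).
-/

namespace AntichainResolution

/-! ### The boundary operator of a simplex -/

section Simplex

variable {L : Type*} [DecidableEq L]

/-- The incidence sign of the face `T` in the simplex `T ∪ {y}`, whose vertices are ordered
by the values of `o`. -/
def koszulSign (o : L → ℕ) (T : Finset L) (y : L) : ℤ :=
  (-1) ^ ((insert y T).filter fun z => o z < o y).card

lemma koszulSign_eq (o : L → ℕ) (T : Finset L) (y : L) :
    koszulSign o T y = (-1) ^ (T.filter fun z => o z < o y).card := by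
  rw [koszulSign, Finset.filter_insert, if_neg (lt_irrefl _)]

lemma koszulSign_insert (o : L → ℕ) {T : Finset L} {x : L} (y : L) (hx : x ∉ T) :
    koszulSign o (insert x T) y =
      if o x < o y then -koszulSign o T y else koszulSign o T y := by
  rw [koszulSign_eq, koszulSign_eq, Finset.filter_insert]
  split_ifs with h
  · rw [Finset.card_insert_of_notMem (by simp [hx]), pow_succ, mul_neg_one]
  · rfl

lemma koszulSign_mul_self (o : L → ℕ) (T : Finset L) (y : L) :
    koszulSign o T y * koszulSign o T y = 1 := by
  rw [koszulSign, ← mul_pow]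
  simp

lemma koszulSign_of_forall_le {o : L → ℕ} {T : Finset L} {x : L} (h : ∀ z ∈ T, o x ≤ o z) :
    koszulSign o T x = 1 := by
  rw [koszulSign_eq, Finset.filter_false_of_mem fun z hz => (h z hz).not_gt]
  simp

/-- Removing two vertices in the two possible orders gives opposite signs. -/
lemma koszulSign_mul_swap {o : L → ℕ} {T : Finset L} {x y : L} (hx : x ∉ T) (hy : y ∉ T)
    (hxy : o x ≠ o y) :
    koszulSign o T x * koszulSign o (insert x T) y =
      -(koszulSign o T y * koszulSign o (insert y T) x) := by
  rw [koszulSign_insert o y hx, koszulSign_insert o x hy]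
  rcases lt_or_gt_of_ne hxy with h | h
  · rw [if_pos h, if_neg h.not_gt]; ring
  · rw [if_neg h.not_gt, if_pos h]; ring

variable {K : Type*} [AddCommGroup K]

/-- The boundary of a chain `φ` of the full simplex with vertex set `C`; chains of all degrees
are treated together, as functions on finite sets, and `φ T` is the coefficient of the simplex
`T`. -/
def simplexBoundary (C : Finset L) (o : L → ℕ) (φ : Finset L → K) (T : Finset L) : K :=
  ∑ y ∈ C \ T, koszulSign o T y • φ (insert y T)

lemma simplexBoundary_simplexBoundary {C : Finset L} {o : L → ℕ}
    (ho : Set.InjOn o (C : Set L)) (φ : Finset L → K) (T : Finset L) :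
    simplexBoundary C o (simplexBoundary C o φ) T = 0 := by
  simp only [simplexBoundary, Finset.smul_sum, smul_smul]
  rw [Finset.sum_sigma']
  refine Finset.sum_involution (fun p _ => ⟨p.2, p.1⟩) ?_ ?_ ?_ ?_
  · rintro ⟨x, y⟩ h
    simp only [Finset.mem_sigma, Finset.mem_sdiff, Finset.mem_insert, not_or] at h
    have hxy : o x ≠ o y := fun e => h.2.2.1 (ho h.1.1 h.2.1 e).symm
    simp only
    rw [koszulSign_mul_swap h.1.2 h.2.2.2 hxy, Finset.insert_comm, neg_smul, neg_add_cancel]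
  · rintro ⟨x, y⟩ h _ e
    simp only [Finset.mem_sigma, Finset.mem_sdiff, Finset.mem_insert, not_or] at h
    exact h.2.2.1 (Sigma.mk.inj_iff.1 e).1
  · rintro ⟨x, y⟩ h
    simp only [Finset.mem_sigma, Finset.mem_sdiff, Finset.mem_insert, not_or] at h ⊢
    exact ⟨⟨h.2.1, h.2.2.2⟩, h.1.1, fun e => h.2.2.1 e.symm, h.1.2⟩
  · rintro ⟨x, y⟩ h
    rfl

/-- The cone operator with apex `x`, which joins `x` to every simplex not containing it. -/
def cone (x : L) (φ : Finset L → K) (S : Finset L) : K :=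
  if x ∈ S then φ (S.erase x) else 0

/-- If the chain `φ` lives on the face `D` of the simplex `C`, then the cone operator whose apex
is the first vertex of `D` is a contracting homotopy. -/
lemma simplexBoundary_cone {C D : Finset L} {o : L → ℕ} (ho : Set.InjOn o (C : Set L))
    (hD : D ⊆ C) {x : L} (hx : x ∈ D) (hmin : ∀ z ∈ D, o x ≤ o z) {φ : Finset L → K}
    (hφ : ∀ S, ¬ S ⊆ D → φ S = 0) {T : Finset L}
    (hcycle : x ∈ T → simplexBoundary C o φ (T.erase x) = 0) :
    simplexBoundary C o (cone x φ) T = φ T := by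
  by_cases hxT : x ∈ T
  · have h := hcycle hxT
    have hset : C \ T.erase x = insert x (C \ T) := by
      ext z
      by_cases hz : z = x
      · subst hz; simp [hD hx]
      · simp [hz]
    rw [simplexBoundary, hset, Finset.sum_insert (by simp [hxT]), Finset.insert_erase hxT] at h
    -- The remaining terms of the cycle condition at `T \ {x}` cancel the boundary of the cone:
    -- passing from `T \ {x}` to `T` puts `x` before `y`, which changes the sign.
    have hsum : ∀ y ∈ C \ T, koszulSign o (T.erase x) y • φ (insert y (T.erase x)) =
        -(koszulSign o T y • cone x φ (insert y T)) := by
      intro y hy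
      rw [Finset.mem_sdiff] at hy
      have hyx : y ≠ x := fun e => hy.2 (e ▸ hxT)
      rw [cone, if_pos (Finset.mem_insert_of_mem hxT), Finset.erase_insert_of_ne hyx]
      by_cases hyD : y ∈ D
      · have hlt : o x < o y :=
          lt_of_le_of_ne (hmin y hyD) fun e => hyx (ho (hD hx) hy.1 e).symm
        have := koszulSign_insert o y (Finset.notMem_erase x T)
        rw [Finset.insert_erase hxT, if_pos hlt] at this
        rw [this, neg_smul, neg_neg]
      · rw [hφ _ fun e => hyD (e (Finset.mem_insert_self _ _))]
        simp
    by_cases hTD : T ⊆ D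
    · rw [Finset.sum_congr rfl hsum, Finset.sum_neg_distrib,
        koszulSign_of_forall_le fun z hz => hmin z (hTD (Finset.mem_of_mem_erase hz)), one_smul,
        ← sub_eq_add_neg, sub_eq_zero] at h
      exact h.symm
    · rw [Finset.sum_congr rfl hsum, Finset.sum_neg_distrib, hφ T hTD, smul_zero, zero_add,
        neg_eq_zero] at h
      rw [hφ T hTD]
      exact h
  · rw [simplexBoundary, Finset.sum_eq_single_of_mem x (Finset.mem_sdiff.2 ⟨hD hx, hxT⟩)]
    · rw [cone, if_pos (Finset.mem_insert_self _ _), Finset.erase_insert hxT]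
      by_cases hTD : T ⊆ D
      · rw [koszulSign_of_forall_le fun z hz => hmin z (hTD hz), one_smul]
      · rw [hφ T hTD, smul_zero]
    · intro y _ hy
      rw [cone, if_neg (by simp [hxT, hy.symm]), smul_zero]

end Simplex

/-! ### The projective modules `P(a)` -/

section Projective

variable {K : Type*} [Field K] {L : Type*} [Lattice L] [LocallyFiniteOrder L] [DecidableEq L]

lemma path_mul_apply {a b : L} (hab : a ≤ b) (f : IncidenceAlgebra K L) (v : L) :
    (path K a b * f) a v = f b v := by
  classical
  rw [IncidenceAlgebra.mul_apply]
  by_cases hbv : b ≤ v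
  · rw [Finset.sum_eq_single_of_mem b (Finset.mem_Icc.2 ⟨hab, hbv⟩)]
    · simp [path_apply, hab]
    · intro w _ hw
      simp [path_apply, hw]
  · rw [IncidenceAlgebra.apply_eq_zero_of_not_le hbv]
    refine Finset.sum_eq_zero fun w hw => ?_
    have : w ≠ b := fun e => hbv (e ▸ (Finset.mem_Icc.1 hw).2)
    simp [path_apply, this]

lemma path_mul_apply_of_ne {a b u : L} (hu : u ≠ a) (f : IncidenceAlgebra K L) (v : L) :
    (path K a b * f) u v = 0 := by
  classical
  rw [IncidenceAlgebra.mul_apply]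
  exact Finset.sum_eq_zero fun w _ => by simp [path_apply, hu]

lemma mem_projModule_iff {a : L} {f : IncidenceAlgebra K L} :
    f ∈ projModule K a ↔ path K a a * f = f := by
  refine ⟨fun h => ?_, fun h => h ▸ path_mul_mem K a a f⟩
  obtain ⟨r, rfl⟩ := Submodule.mem_span_singleton.1 h
  rw [mul_smul_comm, path_self_mul_path]

/-- An element `f` of `P(a)` is determined by the function `f a`, its row at `a`. -/
lemma projModule_ext {a : L} {f g : projModule K a}
    (h : ∀ v, (f : IncidenceAlgebra K L) a v = (g : IncidenceAlgebra K L) a v) : f = g := by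
  refine Subtype.ext (IncidenceAlgebra.ext fun u v _ => ?_)
  by_cases hu : u = a
  · rw [hu, h]
  · rw [← mem_projModule_iff.1 f.2, ← mem_projModule_iff.1 g.2, path_mul_apply_of_ne hu,
      path_mul_apply_of_ne hu]

/-- The element of `P(a)` whose row at `a` is `c`, cut off outside the up-set of `a`. -/
noncomputable def ofRow (a : L) (c : L → K) : projModule K a :=
  ⟨path K a a * ⟨fun u v => open Classical in if u ≤ v then c v else 0, fun _ _ h => if_neg h⟩,
    path_mul_mem K a a _⟩

open Classical in
lemma ofRow_apply (a : L) (c : L → K) (v : L) :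
    (ofRow a c : IncidenceAlgebra K L) a v = if a ≤ v then c v else 0 := by
  rw [ofRow, path_mul_apply le_rfl]
  rfl

lemma canonicalMap_apply {a b : L} (hab : a ≤ b) (f : projModule K b) (v : L) :
    (canonicalMap K a b f : IncidenceAlgebra K L) a v = (f : IncidenceAlgebra K L) b v :=
  path_mul_apply hab _ v

lemma canonicalMap_self (a : L) : canonicalMap K a a = LinearMap.id :=
  LinearMap.ext fun _ => projModule_ext fun v => canonicalMap_apply le_rfl _ v

instance projective_projModule (a : L) :
    Module.Projective (IncidenceAlgebra K L)ᵐᵒᵖ (projModule K a) := by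
  refine Module.Projective.of_split (M := (IncidenceAlgebra K L)ᵐᵒᵖ)
    { toFun := fun f => op (f : IncidenceAlgebra K L)
      map_add' := fun _ _ => rfl
      map_smul' := fun _ _ => rfl }
    { toFun := fun r => ⟨path K a a * unop r, path_mul_mem K a a _⟩
      map_add' := fun _ _ => Subtype.ext (mul_add _ _ _)
      map_smul' := fun r s => Subtype.ext (mul_smul_comm r (path K a a) (unop s)) } ?_
  ext f : 1
  exact Subtype.ext (mem_projModule_iff.1 f.2)

end Projective

/-! ### Coefficients of the antichain resolution -/

section Coefficients

variable {K : Type*} [Field K] {L : Type*} [Lattice L] [LocallyFiniteOrder L] [DecidableEq L]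
  [OrderBot L] {C : Finset L} {o : L → ℕ} {r : ℕ}

instance projective_term (C : Finset L) (r : ℕ) :
    Module.Projective (IncidenceAlgebra K L)ᵐᵒᵖ (Term K C r) :=
  Module.Projective.of_equiv' (DFinsupp.linearEquivFunOnFintype (R := (IncidenceAlgebra K L)ᵐᵒᵖ)
    (M := fun S : {S : Finset L // S ∈ C.powersetCard r} => projModule K (S.1.sup id)))

/-- The part of `f ∈ P_r` in the vertex space at `v`, as a chain of the simplex on `C`: the
summand `P(⋁ S)` contributes the coefficient of `p_{⋁ S}^v` to the simplex `S`. -/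
noncomputable def coeff (f : Term K C r) (v : L) (S : Finset L) : K :=
  if h : S ∈ C.powersetCard r then (f ⟨S, h⟩ : IncidenceAlgebra K L) (S.sup id) v else 0

lemma coeff_of_mem (f : Term K C r) (v : L) (S : {S : Finset L // S ∈ C.powersetCard r}) :
    coeff f v S.1 = (f S : IncidenceAlgebra K L) (S.1.sup id) v := dif_pos S.2

lemma coeff_of_notMem (f : Term K C r) (v : L) {S : Finset L} (h : S ∉ C.powersetCard r) :
    coeff f v S = 0 := dif_neg h

lemma term_ext {f g : Term K C r} (h : ∀ v, ∀ S ∈ C.powersetCard r, coeff f v S = coeff g v S) :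
    f = g := by
  funext S
  refine projModule_ext fun v => ?_
  rw [← coeff_of_mem, ← coeff_of_mem, h v _ S.2]

lemma coeff_of_not_le (f : Term K C r) {v : L} {S : Finset L} (h : ¬ S.sup id ≤ v) :
    coeff f v S = 0 := by
  unfold coeff
  split_ifs
  · exact IncidenceAlgebra.apply_eq_zero_of_not_le h _
  · rfl

lemma coeff_zero (v : L) (S : Finset L) : coeff (0 : Term K C r) v S = 0 := by
  unfold coeff
  split_ifs <;> rfl

/-- The chain of `f` at `v` lives on the face of the simplex spanned by the vertices below `v`. -/
lemma coeff_of_not_subset [DecidableLE L] (f : Term K C r) {v : L} {S : Finset L}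
    (h : ¬ S ⊆ C.filter (· ≤ v)) : coeff f v S = 0 := by
  by_cases hS : S ∈ C.powersetCard r
  · refine coeff_of_not_le f fun hv => h fun z hz => ?_
    exact Finset.mem_filter.2 ⟨(Finset.mem_powersetCard.1 hS).1 hz,
      (Finset.le_sup (f := id) hz).trans hv⟩
  · exact coeff_of_notMem f v hS

lemma boundary_apply (f : Term K C (r + 1)) (T : {S : Finset L // S ∈ C.powersetCard r}) :
    boundary K C o r f T = ∑ y : {y : L // y ∈ C \ T.1}, koszulSign o T.1 y.1 •
      canonicalMap K (T.1.sup id) ((insert y.1 T.1).sup id)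
        (f ⟨insert y.1 T.1, insert_mem T.2 y.2⟩) := by
  simp [boundary, koszulSign]

lemma coeff_boundary (f : Term K C (r + 1)) (v : L) {T : Finset L} (hT : T ∈ C.powersetCard r) :
    coeff (boundary K C o r f) v T = simplexBoundary C o (coeff f v) T := by
  let ev : IncidenceAlgebra K L →+ K :=
    { toFun := fun g => g (T.sup id) v, map_zero' := rfl, map_add' := fun _ _ => rfl }
  have h := boundary_apply (o := o) f ⟨T, hT⟩
  have h' := congrArg (fun g => ev (Submodule.subtype _ g)) h
  simp only [map_sum, map_zsmul] at h'
  rw [coeff, dif_pos hT, simplexBoundary, ← Finset.sum_coe_sort]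
  refine h'.trans (Finset.sum_congr rfl fun y _ => ?_)
  congr 1
  rw [coeff, dif_pos (insert_mem hT y.2)]
  exact canonicalMap_apply (Finset.sup_mono (Finset.subset_insert _ _)) _ v

/-- The element of `P_r` whose chain at each `v` is `c v`, restricted to the simplices `S` with
`⋁ S ≤ v`. -/
noncomputable def ofCoeff (c : L → Finset L → K) : Term K C r :=
  fun S => ofRow (S.1.sup id) fun v => c v S.1

open Classical in
lemma coeff_ofCoeff (c : L → Finset L → K) (v : L) {S : Finset L} (hS : S ∈ C.powersetCard r) :
    coeff (ofCoeff c : Term K C r) v S = if S.sup id ≤ v then c v S else 0 := by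
  rw [coeff, dif_pos hS]
  exact ofRow_apply _ _ _

end Coefficients

/-! ### Exactness -/

section Exactness

variable {K : Type*} [Field K] {L : Type*} [Lattice L] [LocallyFiniteOrder L] [DecidableEq L]
  [OrderBot L] {C : Finset L} {o : L → ℕ} {r : ℕ}

open Classical in
/-- An element of `P_r` is a boundary as soon as its chain at every `v` vanishes when no vertex is
below `v` and otherwise is a cycle. The cycle condition is only needed for faces of simplices of
dimension at least zero, which makes it empty for `r = 0`. -/
lemma mem_range_boundary (ho : Set.InjOn o (C : Set L)) (f : Term K C r)
    (hf : ∀ v, (∀ x ∈ C, ¬ x ≤ v) → ∀ T ∈ C.powersetCard r, coeff f v T = 0)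
    (hcycle : ∀ v, ∀ T ∈ C.powersetCard r, ∀ x ∈ T,
      simplexBoundary C o (coeff f v) (T.erase x) = 0) :
    ∃ g, boundary K C o r g = f := by
  have key : ∀ v, ∃ c : Finset L → K, (∀ S ∈ C.powersetCard (r + 1), ¬ S.sup id ≤ v → c S = 0) ∧
      ∀ T ∈ C.powersetCard r, simplexBoundary C o c T = coeff f v T := by
    intro v
    by_cases hv : ∃ x ∈ C, x ≤ v
    · obtain ⟨x₀, hx₀, hx₀v⟩ := hv
      obtain ⟨x, hx, hmin⟩ := (C.filter (· ≤ v)).exists_min_image o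
        ⟨x₀, Finset.mem_filter.2 ⟨hx₀, hx₀v⟩⟩
      refine ⟨cone x (coeff f v), fun S _ hS => ?_, fun T hT => ?_⟩
      · rw [cone]
        split_ifs with hxS
        · refine coeff_of_not_le f fun h => hS ?_
          rw [← Finset.insert_erase hxS, Finset.sup_insert]
          exact sup_le (Finset.mem_filter.1 hx).2 h
        · rfl
      · exact simplexBoundary_cone ho (Finset.filter_subset _ _) hx hmin
          (fun S hS => coeff_of_not_subset f hS) (hcycle v T hT x)
    · push Not at hv
      refine ⟨fun _ => 0, fun _ _ _ => rfl, fun T hT => ?_⟩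
      rw [hf v hv T hT]
      simp [simplexBoundary]
  choose c hc hcb using key
  refine ⟨ofCoeff c, term_ext fun v T hT => ?_⟩
  rw [coeff_boundary _ _ hT, ← hcb v T hT]
  refine Finset.sum_congr rfl fun y hy => ?_
  rw [coeff_ofCoeff _ _ (insert_mem hT hy)]
  split_ifs with h
  · rfl
  · rw [hc v _ (insert_mem hT hy) h]

/-- In degree at least one, every face of a chain at `v` is nonempty, so the chain vanishes unless
some vertex lies below `v`, as `mem_range_boundary` requires. -/
lemma exact_boundary (ho : Set.InjOn o (C : Set L)) (r : ℕ) :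
    Function.Exact (boundary K C o (r + 1)) (boundary K C o r) := by
  intro f
  constructor
  · intro h
    have hD : ∀ v, ∀ T ∈ C.powersetCard r, simplexBoundary C o (coeff f v) T = 0 := by
      intro v T hT
      rw [← coeff_boundary f v hT, h, coeff_zero]
    refine mem_range_boundary ho f (fun v hv T hT => coeff_of_not_le f fun hTv => ?_) ?_
    · obtain ⟨hTC, hcard⟩ := Finset.mem_powersetCard.1 hT
      obtain ⟨x, hx⟩ := Finset.card_pos.1 (hcard.symm ▸ Nat.succ_pos r : 0 < T.card)
      exact hv x (hTC hx) ((Finset.le_sup (f := id) hx).trans hTv)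
    · intro v T hT x hx
      obtain ⟨hTC, hcard⟩ := Finset.mem_powersetCard.1 hT
      refine hD v _ (Finset.mem_powersetCard.2 ⟨(Finset.erase_subset _ _).trans hTC, ?_⟩)
      rw [Finset.card_erase_of_mem hx, hcard, Nat.add_sub_cancel]
  · rintro ⟨g, rfl⟩
    refine term_ext fun v T hT => ?_
    rw [coeff_boundary _ _ hT, coeff_zero, ← simplexBoundary_simplexBoundary ho (coeff g v) T]
    exact Finset.sum_congr rfl fun y hy => by rw [coeff_boundary _ _ (insert_mem hT hy)]

lemma augmentation_eq_zero_iff (f : Term K C 0) :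
    augmentation K C f = 0 ↔
      (f ⟨∅, by simp⟩ : IncidenceAlgebra K L) ∈ antichainIdeal K C := by
  have h : canonicalMap K (⊥ : L) ((∅ : Finset L).sup id) (f ⟨∅, by simp⟩) = f ⟨∅, by simp⟩ :=
    LinearMap.congr_fun (canonicalMap_self (K := K) (⊥ : L)) _
  simp only [augmentation, LinearMap.comp_apply, LinearMap.proj_apply, h]
  exact Submodule.Quotient.mk_eq_zero _

lemma apply_bot_eq_zero_of_mem_antichainIdeal {f : IncidenceAlgebra K L}
    (hf : f ∈ antichainIdeal K C) {v : L} (hv : ∀ x ∈ C, ¬ x ≤ v) : f ⊥ v = 0 := by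
  induction hf using Submodule.closure_induction with
  | zero => rfl
  | add f g _ _ hf hg => rw [IncidenceAlgebra.add_apply, hf, hg, add_zero]
  | smul_mem r f hf =>
    obtain ⟨x, hx, rfl⟩ := hf
    change (path K ⊥ x * unop r) ⊥ v = 0
    rw [path_mul_apply bot_le, IncidenceAlgebra.apply_eq_zero_of_not_le (hv x hx)]

/-- In degree zero the condition of `mem_range_boundary` is that the row of `f` at the minimum
vanishes at every `v` with no element of `C` below it; this holds on `N_C`. -/
lemma exact_augmentation (ho : Set.InjOn o (C : Set L)) :
    Function.Exact (boundary K C o 0) (augmentation K C) := by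
  intro f
  rw [augmentation_eq_zero_iff]
  constructor
  · intro h
    refine mem_range_boundary ho f (fun v hv T hT => ?_) fun v T hT x hx => ?_
    · obtain rfl : T = ∅ := by simpa using hT
      rw [coeff, dif_pos hT]
      exact apply_bot_eq_zero_of_mem_antichainIdeal h hv
    · obtain rfl : T = ∅ := by simpa using hT
      simp at hx
  · rintro ⟨g, rfl⟩
    rw [boundary_apply, Submodule.coe_sum]
    refine Submodule.sum_mem _ fun y _ => ?_
    rw [Submodule.coe_smul_of_tower]
    refine zsmul_mem ?_ _
    have hy : (insert y.1 (∅ : Finset L)).sup id ∈ C := by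
      simpa using (Finset.mem_sdiff.1 y.2).1
    exact Submodule.smul_mem _ (op (g _ : IncidenceAlgebra K L))
      (Submodule.subset_span ⟨_, hy, rfl⟩ : path K ⊥ _ ∈ antichainIdeal K C)

lemma surjective_augmentation : Function.Surjective (augmentation K C) := by
  intro m
  obtain ⟨p, rfl⟩ := Submodule.mkQ_surjective _ m
  refine ⟨fun S => canonicalMap K (S.1.sup id) ⊥ p, ?_⟩
  have h : canonicalMap K (⊥ : L) ⊥ (canonicalMap K (⊥ : L) ⊥ p) = p := by
    rw [canonicalMap_self]; rfl
  exact congrArg (Submodule.mkQ _) h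

lemma isProjectiveResolution (ho : Set.InjOn o (C : Set L)) :
    IsProjectiveResolution (boundary K C o) (augmentation K C) where
  projective _ := inferInstance
  surjective := surjective_augmentation
  exact_zero := exact_augmentation ho
  exact_succ := exact_boundary ho

end Exactness

/-! ### Minimality -/

/-- Strength of `C` says that no edge of the cube of subsets is collapsed by taking joins. -/
lemma isStrong_iff {L : Type*} [Lattice L] [DecidableEq L] [OrderBot L] {C : Finset L} :
    IsStrong C ↔ ∀ T ⊆ C, ∀ y ∈ C \ T, (insert y T).sup id ≠ T.sup id := by
  constructor
  · intro h T hT y hy e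
    rw [Finset.mem_sdiff] at hy
    exact hy.2 (h _ (Finset.insert_subset hy.1 hT) _ hT e.le (Finset.mem_insert_self _ _))
  · intro h S hS S' hS' hle y hy
    by_contra hyS'
    refine h S' hS' y (Finset.mem_sdiff.2 ⟨hS hy, hyS'⟩) ?_
    rw [Finset.sup_insert, sup_eq_right]
    exact (Finset.le_sup (f := id) hy).trans hle

section Minimality

variable {K : Type*} [Field K] {L : Type*} [Lattice L] [LocallyFiniteOrder L] [DecidableEq L]
  [OrderBot L] {C : Finset L} {o : L → ℕ} {r : ℕ}

/-- The generator `p_{⋁ S}^{⋁ S}` of the summand `P(⋁ S)` of `P_r`. -/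
noncomputable def generator (S : {S : Finset L // S ∈ C.powersetCard r}) : Term K C r :=
  Pi.single S ⟨path K (S.1.sup id) (S.1.sup id), Submodule.mem_span_singleton_self _⟩

lemma eq_sum_generator_smul (f : Term K C r) :
    f = ∑ S, op (f S : IncidenceAlgebra K L) • generator S := by
  conv_lhs => rw [← Finset.univ_sum_single f]
  refine Finset.sum_congr rfl fun S _ => ?_
  rw [generator, ← Pi.single_smul]
  congr 1
  exact Subtype.ext (mem_projModule_iff.1 (f S).2).symm

lemma coeff_generator (S : {S : Finset L // S ∈ C.powersetCard r}) (T : Finset L) :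
    coeff (generator S : Term K C r) (T.sup id) T = if T = S.1 then 1 else 0 := by
  classical
  by_cases hT : T ∈ C.powersetCard r
  · rw [coeff, dif_pos hT, generator]
    by_cases h : T = S.1
    · obtain ⟨S, hS⟩ := S
      subst h
      simp [path_apply]
    · rw [Pi.single_eq_of_ne (fun e => h (congrArg Subtype.val e)), if_neg h]
      rfl
  · rw [coeff_of_notMem _ _ hT, if_neg (by rintro rfl; exact hT S.2)]

/-- The action of the algebra is triangular: it multiplies leading coefficients. -/
lemma coeff_smul_sup (f : Term K C r) (a : (IncidenceAlgebra K L)ᵐᵒᵖ) (S : Finset L) :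
    coeff (a • f) (S.sup id) S = coeff f (S.sup id) S * unop a (S.sup id) (S.sup id) := by
  unfold coeff
  split_ifs with h
  · change ((f ⟨S, h⟩ : IncidenceAlgebra K L) * unop a) _ _ = _
    rw [IncidenceAlgebra.mul_apply, Finset.Icc_self, Finset.sum_singleton]
  · rw [zero_mul]

lemma coeff_add (f g : Term K C r) (v : L) (S : Finset L) :
    coeff (f + g) v S = coeff f v S + coeff g v S := by
  unfold coeff
  split_ifs
  · rfl
  · rw [add_zero]

/-- A submodule of `P_r` whose elements have no leading coefficients, that is, which is contained
in the radical of `P_r`, is superfluous. -/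
lemma isSuperfluous_of_coeff_sup_eq_zero [Finite L]
    (N : Submodule (IncidenceAlgebra K L)ᵐᵒᵖ (Term K C r))
    (hN : ∀ f ∈ N, ∀ S ∈ C.powersetCard r, coeff f (S.sup id) S = 0) : IsSuperfluous N := by
  intro X hX
  -- Induction on the join takes the place of the nilpotency of the radical.
  have key : ∀ w : L, ∀ S : {S : Finset L // S ∈ C.powersetCard r}, S.1.sup id = w →
      generator S ∈ X := by
    intro w
    induction w using WellFoundedLT.induction with
    | ind w ih =>
      rintro S rfl
      obtain ⟨n, hn, x, hx, hnx⟩ := Submodule.mem_sup.1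
        (hX ▸ Submodule.mem_top : (generator S : Term K C r) ∈ N ⊔ X)
      -- Multiplying by the idempotent at `⋁ S` leaves in `n` only generators of smaller joins.
      set e : (IncidenceAlgebra K L)ᵐᵒᵖ := op (path K (S.1.sup id) (S.1.sup id)) with he
      have hgen : e • (generator S : Term K C r) = generator S := by
        rw [generator, ← Pi.single_smul]
        congr 1
        exact Subtype.ext (path_self_mul_path K _ _)
      have hen : e • n ∈ X := by
        rw [eq_sum_generator_smul (e • n)]
        refine Submodule.sum_mem _ fun T _ => ?_
        by_cases hlt : T.1.sup id < S.1.sup id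
        · exact X.smul_mem _ (ih _ hlt T rfl)
        · have hz : (e • n) T = 0 := by
            classical
            refine projModule_ext fun v => ?_
            change ((n T : IncidenceAlgebra K L) * path K (S.1.sup id) (S.1.sup id)) _ v = 0
            rw [IncidenceAlgebra.mul_apply]
            refine Finset.sum_eq_zero fun u _ => ?_
            by_cases hu : u = S.1.sup id
            · rw [mul_eq_zero]
              left
              by_cases hle : T.1.sup id ≤ u
              · have hTu : u = T.1.sup id :=
                  (hle.lt_or_eq.resolve_left fun h => hlt (hu ▸ h)).symm
                rw [← coeff_of_mem, hTu]
                exact hN n hn T.1 T.2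
              · exact IncidenceAlgebra.apply_eq_zero_of_not_le hle _
            · simp [path_apply, hu]
          rw [hz]
          simp
      rw [← hgen, ← hnx, smul_add]
      exact X.add_mem hen (X.smul_mem _ hx)
  refine eq_top_iff.2 fun f _ => ?_
  rw [eq_sum_generator_smul f]
  exact Submodule.sum_mem _ fun S _ => X.smul_mem _ (key _ S rfl)

/-- For strong `C`, no component of the boundary map is an isomorphism, so boundaries have no
leading coefficients. -/
lemma coeff_boundary_sup_of_isStrong (h : IsStrong C) (g : Term K C (r + 1)) {T : Finset L}
    (hT : T ∈ C.powersetCard r) : coeff (boundary K C o r g) (T.sup id) T = 0 := by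
  rw [coeff_boundary _ _ hT]
  refine Finset.sum_eq_zero fun y hy => ?_
  rw [coeff_of_not_le, smul_zero]
  intro hle
  exact isStrong_iff.1 h T (Finset.mem_powersetCard.1 hT).1 y hy
    (le_antisymm hle (Finset.sup_mono (Finset.subset_insert _ _)))

/-- A component `P(⋁ (T ∪ {y})) → P(⋁ T)` of a boundary map with superfluous range is not an
isomorphism: otherwise the range, together with the proper submodule of the elements without leading
coefficient at `T`, would generate `P_r`. -/
lemma sup_insert_ne_of_isSuperfluous {T : Finset L} (hT : T ∈ C.powersetCard r) {y : L}
    (hy : y ∈ C \ T)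
    (h : IsSuperfluous (LinearMap.range (boundary K C o r))) :
    (insert y T).sup id ≠ T.sup id := by
  intro e
  let X : Submodule (IncidenceAlgebra K L)ᵐᵒᵖ (Term K C r) :=
    { carrier := {f | coeff f (T.sup id) T = 0}
      zero_mem' := coeff_zero _ _
      add_mem' := fun {f g} hf hg => by
        rw [Set.mem_ofPred_eq] at hf hg ⊢
        rw [coeff_add, hf, hg, add_zero]
      smul_mem' := fun a f hf => by
        rw [Set.mem_ofPred_eq] at hf ⊢
        rw [coeff_smul_sup, hf, zero_mul] }
  set b := boundary K C o r (generator ⟨insert y T, insert_mem hT hy⟩) with hb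
  have hcoeff : coeff b (T.sup id) T = koszulSign o T y := by
    rw [hb, coeff_boundary _ _ hT, simplexBoundary, Finset.sum_eq_single_of_mem y hy]
    · rw [← e, coeff_generator, if_pos rfl, zsmul_one]
    · intro z hz hzy
      have hne : insert z T ≠ insert y T := fun h' =>
        hzy ((Finset.mem_insert.1 (h' ▸ Finset.mem_insert_self z T)).resolve_right
          (Finset.mem_sdiff.1 hz).2)
      -- When `⋁ (T ∪ {z}) = ⋁ T` as well, the coefficient is the one at a different generator.
      by_cases hle : (insert z T).sup id ≤ T.sup id
      · have hz' : (insert z T).sup id = T.sup id :=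
          le_antisymm hle (Finset.sup_mono (Finset.subset_insert _ _))
        rw [← hz', coeff_generator, if_neg hne, smul_zero]
      · rw [coeff_of_not_le _ hle, smul_zero]
  have htop : LinearMap.range (boundary K C o r) ⊔ X = ⊤ := by
    refine eq_top_iff.2 fun f _ => ?_
    set a : (IncidenceAlgebra K L)ᵐᵒᵖ :=
      op (((koszulSign o T y : K) * coeff f (T.sup id) T) • (1 : IncidenceAlgebra K L)) with ha
    refine Submodule.mem_sup.2 ⟨a • b, Submodule.smul_mem _ _ ⟨_, rfl⟩, f - a • b, ?_,
      add_sub_cancel _ _⟩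
    have hab : coeff (a • b) (T.sup id) T = coeff f (T.sup id) T := by
      have hs : (koszulSign o T y : K) * koszulSign o T y = 1 := by
        exact_mod_cast congrArg (Int.cast (R := K)) (koszulSign_mul_self o T y)
      rw [coeff_smul_sup, hcoeff, ha, unop_op, IncidenceAlgebra.constSMul_apply,
        IncidenceAlgebra.one_apply, if_pos rfl, smul_eq_mul, mul_one, ← mul_assoc, hs, one_mul]
    have hadd := coeff_add (f - a • b) (a • b) (T.sup id) T
    rw [sub_add_cancel, hab] at hadd
    exact left_eq_add.1 (hadd.trans (add_comm _ _))
  have hmem : (generator ⟨T, hT⟩ : Term K C r) ∈ X := h X htop ▸ Submodule.mem_top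
  have h1 : coeff (generator ⟨T, hT⟩ : Term K C r) (T.sup id) T = 0 := hmem
  rw [coeff_generator, if_pos rfl] at h1
  exact one_ne_zero h1

lemma isMinimalProjectiveResolution_iff [Finite L] (ho : Set.InjOn o (C : Set L)) :
    IsMinimalProjectiveResolution (boundary K C o) (augmentation K C) ↔ IsStrong C := by
  have h₀ : LinearMap.ker (augmentation K C) = LinearMap.range (boundary K C o 0) :=
    LinearMap.exact_iff.1 (exact_augmentation ho)
  have h₁ : ∀ r, LinearMap.ker (boundary K C o r) = LinearMap.range (boundary K C o (r + 1)) :=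
    fun r => LinearMap.exact_iff.1 (exact_boundary ho r)
  constructor
  · intro h
    have hr : ∀ r, IsSuperfluous (LinearMap.range (boundary K C o r)) := by
      rintro (_ | r)
      · exact h₀ ▸ h.superfluous_zero
      · exact h₁ r ▸ h.superfluous_succ r
    exact isStrong_iff.2 fun T hT y hy =>
      sup_insert_ne_of_isSuperfluous (Finset.mem_powersetCard.2 ⟨hT, rfl⟩) hy (hr _)
  · intro h
    have hr : ∀ r, IsSuperfluous (LinearMap.range (boundary K C o r)) := by
      intro r
      refine isSuperfluous_of_coeff_sup_eq_zero _ ?_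
      rintro _ ⟨g, rfl⟩ S hS
      exact coeff_boundary_sup_of_isStrong h g hS
    exact
      { isProjectiveResolution ho with
        superfluous_zero := h₀ ▸ hr 0
        superfluous_succ := fun r => h₁ r ▸ hr (r + 1) }

end Minimality

end AntichainResolution

/-- For every antichain `C` of a finite lattice `L` and every ordering of `C` (given by the values
of `o`), the antichain resolution is a projective resolution of `M_C`, and it is minimal if and
only if `C` is strong. -/
theorem lemma4p1 {K : Type*} [Field K] {L : Type*} [Lattice L] [OrderBot L] [Finite L]
    [LocallyFiniteOrder L] [DecidableEq L] (C : Finset L)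
    (hC : IsAntichain (· ≤ ·) (C : Set L)) (o : L → ℕ) (ho : Set.InjOn o (C : Set L)) :
    AntichainResolution.IsProjectiveResolution
        (AntichainResolution.boundary K C o) (AntichainResolution.augmentation K C) ∧
      (AntichainResolution.IsMinimalProjectiveResolution
          (AntichainResolution.boundary K C o) (AntichainResolution.augmentation K C) ↔
        AntichainResolution.IsStrong C) :=
  ⟨AntichainResolution.isProjectiveResolution ho,
    AntichainResolution.isMinimalProjectiveResolution_iff ho⟩
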